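/- For $0<\alpha<1$ and $0<\beta\le 1$ let $T_{\alpha,\beta}:[0,1]\to[0,1]$ be the skew tent map $T_{\alpha,\beta}(x)=\frac{\beta}{\alpha}x$ for $0\le x\le\alpha$ and $T_{\alpha,\beta}(x)=\frac{\beta}{1-\alpha}(1-x)$ for $\alpha<x\le 1$, and let $U=\{(\alpha,\beta): \tfrac12<\beta\le 1,\ 1-\beta<\alpha<\beta\}$. The extended itinerary of $x$ has $n$-th entry ($n\ge 0$) $L$, $C$ or $R$ according to whether $T_{\alpha,\beta}^n(x)$ is less than, equal to or greater than $\alpha$; the itinerary of $x$ is obtained from it by stopping right after the first $C$, if there is one. The kneading sequence $K(\alpha,\beta)$ is the itinerary of $\beta=T_{\alpha,\beta}(\alpha)$. Put $L\prec C\prec R$, and for strings $\underline A\ne \underline B$ that first differ at the $n$-th entry let $\underline A\prec\underline B$ if either $A_0\dots A_{n-1}$ contains an even number of $R$'s and $A_n\prec B_n$, or it contains an odd number of $R$'s and $B_n\prec A_n$. Let $\mathfrak M=\{K(\tfrac12,\beta):\tfrac12<\beta\le 1\}$, and let $\mathfrak M_\infty$ be the set of those members of $\mathfrak M$ that do not contain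 $C$. For an infinite string $\underline M=RL^{m_1}RL^{m_2}RL^{m_3}R\dots$ (all $m_k\ge 0$) put $\overline m_k=m_1+\dots+m_k$ and $$\Theta_{\underline M}(\alpha,\beta)=1-\beta+\sum_{k=1}^{\infty}(-1)^k\left(\frac{1-\alpha}{\beta}\right)^k\left(\frac{\alpha}{\beta}\right)^{\overline m_k}\qquad((\alpha,\beta)\in U).$$ **Theorem.** Let $\underline M=RL^{m_1}RL^{m_2}RL^{m_3}R\dots$ with $m_1=6$, $m_{2k}=5$ and $m_{2k+1}=0$ for $1\le k\le 23$, and $m_k=0$ for $k\ge 48$. Then $\underline M\in\mathfrak M_\infty\setminus\{RL^\infty\}$, and there is $(\alpha,\beta)\in U$ with $\alpha=0.4875$ such that $\Theta_{\underline M}(\alpha,\beta)=0$ but $K(\alpha,\beta)\ne\underline M$; moreover $K(\alpha,\beta)\prec\underline M$ there. In fact $K(\alpha,\beta)\prec\underline M$ holds for every $(\alpha,\beta)\in U$ with $\Theta_{\underline M}(\alpha,\beta)=0$ and $K(\alpha,\beta)\neq\underline M$. Consequently the equi-kneading curve $\{(\alpha,\beta)\in U:K(\alpha,\beta)=\underline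 M\}$ is a proper subset of the zero set $\{(\alpha,\beta)\in U:\Theta_{\underline M}(\alpha,\beta)=0\}$. -/

import Mathlib

namespace SkewTent

/-- The three symbols used in itineraries: left, turning point, right. -/
inductive Letter where
  | L
  | C
  | R
  deriving DecidableEq

/-- The position of a letter in the order `L ≺ C ≺ R`. -/
def Letter.rank : Letter → ℕ
  | .L => 0
  | .C => 1
  | .R => 2

/-- A finite or infinite string of letters: `A n` is the `n`-th entry (counted from `0`), and
`A n = none` if the string has ended before position `n`. -/
abbrev Word : Type := ℕ → Option Letter

/-- The symbolic ordering `A ≺ B`: at the first place `n` where the strings differ,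
`Aₙ ≺ Bₙ` if `A₀ … Aₙ₋₁` contains an even number of `R`s, and `Bₙ ≺ Aₙ` otherwise. -/
def Word.Prec (A B : Word) : Prop :=
  ∃ n : ℕ, (∀ i < n, A i = B i) ∧ ∃ a b : Letter, A n = some a ∧ B n = some b ∧
    ((Even ((Finset.range n).filter fun i => A i = some Letter.R).card ∧ a.rank < b.rank) ∨
     (Odd ((Finset.range n).filter fun i => A i = some Letter.R).card ∧ b.rank < a.rank))

/-- The skew tent map with turning point `(α, β)`. -/
noncomputable def tent (α β x : ℝ) : ℝ :=
  if x ≤ α then β / α * x else β / (1 - α) * (1 - x)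

/-- The parameter region of the pairs `(α, β)`. -/
def U : Set (ℝ × ℝ) :=
  {p | 1 / 2 < p.2 ∧ p.2 ≤ 1 ∧ 1 - p.2 < p.1 ∧ p.1 < p.2}

/-- The extended itinerary of `x`. -/
noncomputable def extItinerary (α β x : ℝ) (n : ℕ) : Letter :=
  if (tent α β)^[n] x < α then Letter.L
  else if (tent α β)^[n] x = α then Letter.C
  else Letter.R

open Classical in
/-- The itinerary of `x`: the extended itinerary, stopped right after its first `C` (if any). -/
noncomputable def itinerary (α β x : ℝ) : Word := fun n =>
  if ∃ k < n, extItinerary α β x k = Letter.C then none else some (extItinerary α β x n)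

/-- The kneading sequence `K(α, β)`: the itinerary of `β = T(α)`. -/
noncomputable def kneading (α β : ℝ) : Word := itinerary α β β

/-- The class `𝔐` of kneading sequences `K(1/2, β)` of the symmetric tent maps, `1/2 < β ≤ 1`. -/
def kneadingClass : Set Word :=
  {M | ∃ β : ℝ, 1 / 2 < β ∧ β ≤ 1 ∧ kneading (1 / 2) β = M}

/-- The class `𝔐_∞` of the members of `𝔐` that do not contain `C`. -/
def kneadingClassInf : Set Word :=
  {M | M ∈ kneadingClass ∧ ∀ n, M n ≠ some Letter.C}

/-- The string `R L^∞`. -/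
def wordRL : Word := fun n => if n = 0 then some Letter.R else some Letter.L

/-- `m̄ₖ = m₁ + ⋯ + mₖ` (the value `m 0` is irrelevant). -/
def blockSum (m : ℕ → ℕ) (k : ℕ) : ℕ := ∑ i ∈ Finset.Icc 1 k, m i

open Classical in
/-- The infinite string `R L^{m₁} R L^{m₂} R L^{m₃} R …`; its `R`s stand exactly at the places
`k + m̄ₖ`, `k = 0, 1, 2, …`. -/
noncomputable def blockWord (m : ℕ → ℕ) : Word := fun n =>
  if ∃ k : ℕ, n = k + blockSum m k then some Letter.R else some Letter.L

/-- `Θ_M(α, β) = 1 - β + ∑_{k ≥ 1} (-1)^k ((1-α)/β)^k (α/β)^{m̄ₖ}` for the infinite string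
`M = R L^{m₁} R L^{m₂} R …` (for which `M⁻ = M`). -/
noncomputable def Theta (m : ℕ → ℕ) (α β : ℝ) : ℝ :=
  1 - β + ∑' j : ℕ,
    (-1 : ℝ) ^ (j + 1) * ((1 - α) / β) ^ (j + 1) * (α / β) ^ blockSum m (j + 1)

/-- The series defining `Θ_M` converges on `U`. -/
theorem summable_Theta (m : ℕ → ℕ) {α β : ℝ} (h : (α, β) ∈ U) :
    Summable fun j : ℕ =>
      (-1 : ℝ) ^ (j + 1) * ((1 - α) / β) ^ (j + 1) * (α / β) ^ blockSum m (j + 1) := by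
  obtain ⟨h1, h2, h3, h4⟩ := h
  simp only at h1 h2 h3 h4
  have hβ : 0 < β := by linarith
  have hα : 0 < α := by linarith
  have q0 : 0 ≤ (1 - α) / β := div_nonneg (by linarith) hβ.le
  have q1 : (1 - α) / β < 1 := by rw [div_lt_one hβ]; linarith
  have r0 : 0 ≤ α / β := by positivity
  have r1 : α / β ≤ 1 := by rw [div_le_one hβ]; linarith
  refine Summable.of_norm_bounded (g := fun j : ℕ => ((1 - α) / β) ^ (j + 1))
    ((summable_nat_add_iff 1).2 (summable_geometric_of_lt_one q0 q1)) fun j => ?_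
  rw [norm_mul, norm_mul, norm_pow, norm_neg, norm_one, one_pow, one_mul,
    Real.norm_of_nonneg (pow_nonneg q0 _), Real.norm_of_nonneg (pow_nonneg r0 _)]
  exact mul_le_of_le_one_right (pow_nonneg q0 _) (pow_le_one₀ r0 r1)

end SkewTent

open SkewTent

namespace SkewTent

/-! ### Block words -/

/-! With `q = (1-α)/β` and `r = α/β`, the inverse branches of the tent map are `y ↦ r y` and `y ↦ 1
- q y`. Applied along a tail of `M`, they give that tail a value in [0,1]. If `Z k` is the value of
the tail at the `k`-th `R` (counted from 0), the series telescopes to `Θ = Z 0 - β` (`Theta_eq`). So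
`Θ = 0` only says that the formal value of `M` is `β`. For `K = M` every proper tail must also have
value below `β`, since `r β = α = 1 - q β` makes this the condition that each preimage falls on the
prescribed side of `α`.

Here `M = R L⁶ (R L⁵ R)²³ R^∞`. Tails preceded by an even, positive number of `R`s have value at
most `1/(1+q)`, which is below `β` because `α < β`; the others have value at most `Z 1`
(`oddTail_mono`). So on the zero set `K = M` iff `Z 1 < β`, and any deviation happens after an odd
number of `R`s, which pushes `K` below `M` (`prec_blockWord`).

On `α = 1/2` a zero with `Z 1 < β` exists (`exists_diag_zero`, `oddTail_diag_lt`), so `M` is a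
kneading sequence. On `α = 0.4875` there is a zero with `β ≤ 0.56`, while `Z 1 ≥ 0.637`
(`exists_exceptional_zero`). -/

/-- The position of the `k`-th `R` in the block word of `m`. -/
def rPos (m : ℕ → ℕ) (k : ℕ) : ℕ := k + blockSum m k

/-- The number of `R`s among the first `n` letters of the block word of `m`. -/
def rCount (m : ℕ → ℕ) : ℕ → ℕ
  | 0 => 0
  | n + 1 => if n = rPos m (rCount m n) then rCount m n + 1 else rCount m n

theorem blockSum_succ (m : ℕ → ℕ) (k : ℕ) : blockSum m (k + 1) = blockSum m k + m (k + 1) := by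
  unfold blockSum
  rw [Finset.sum_Icc_succ_top (by omega)]

theorem rPos_zero (m : ℕ → ℕ) : rPos m 0 = 0 := by simp [rPos, blockSum]

theorem rPos_succ (m : ℕ → ℕ) (k : ℕ) : rPos m (k + 1) = rPos m k + m (k + 1) + 1 := by
  unfold rPos
  rw [blockSum_succ]
  omega

theorem rPos_strictMono (m : ℕ → ℕ) : StrictMono (rPos m) :=
  strictMono_nat_of_lt_succ fun k => by rw [rPos_succ]; omega

/-- With `rPos_lt_of_lt_rCount` this identifies `rCount m n` as the index of the first `R` at or
after position `n`. -/
theorem le_rPos_rCount (m : ℕ → ℕ) (n : ℕ) : n ≤ rPos m (rCount m n) := by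
  induction n with
  | zero => exact Nat.zero_le _
  | succ n ih =>
    rw [rCount]
    split_ifs with h
    · rw [rPos_succ]; omega
    · omega

theorem rPos_lt_of_lt_rCount (m : ℕ → ℕ) (n : ℕ) : ∀ k < rCount m n, rPos m k < n := by
  induction n with
  | zero => intro k hk; simp [rCount] at hk
  | succ n ih =>
    intro k hk
    rw [rCount] at hk
    split_ifs at hk with h
    · have := (rPos_strictMono m).monotone (Nat.lt_succ_iff.1 hk)
      omega
    · exact (ih k hk).trans (Nat.lt_succ_self n)

theorem exists_eq_rPos_iff (m : ℕ → ℕ) (n : ℕ) :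
    (∃ k, n = rPos m k) ↔ n = rPos m (rCount m n) := by
  refine ⟨?_, fun h => ⟨_, h⟩⟩
  rintro ⟨k, hk⟩
  have h1 : rCount m n ≤ k := by
    by_contra! h
    have := rPos_lt_of_lt_rCount m n k h
    omega
  have h2 := (rPos_strictMono m).monotone h1
  have h3 := le_rPos_rCount m n
  omega

theorem rCount_rPos (m : ℕ → ℕ) (k : ℕ) : rCount m (rPos m k) = k :=
  ((rPos_strictMono m).injective ((exists_eq_rPos_iff m _).1 ⟨k, rfl⟩)).symm

theorem rCount_pos (m : ℕ → ℕ) {n : ℕ} (hn : 0 < n) : 0 < rCount m n := by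
  by_contra! h
  have h1 := le_rPos_rCount m n
  rw [Nat.le_zero.1 h, rPos_zero] at h1
  omega

theorem blockWord_eq (m : ℕ → ℕ) (n : ℕ) :
    blockWord m n = if n = rPos m (rCount m n) then some Letter.R else some Letter.L := by
  unfold blockWord
  have h := exists_eq_rPos_iff m n
  unfold rPos at h ⊢
  simp only [h]

theorem card_R_blockWord (m : ℕ → ℕ) (n : ℕ) :
    ((Finset.range n).filter fun i => blockWord m i = some Letter.R).card = rCount m n := by
  induction n with
  | zero => simp [rCount]
  | succ n ih =>
    rw [Finset.range_add_one, Finset.filter_insert, rCount, blockWord_eq]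
    by_cases h : n = rPos m (rCount m n)
    · rw [if_pos (by rw [if_pos h]), if_pos h, Finset.card_insert_of_notMem (by simp), ih]
    · rw [if_neg (by rw [if_neg h]; simp), if_neg h, ih]

/-! ### Values of the tails of a block word -/

/-- `Z k` is the value of the tail of the block word of `m` starting at its `k`-th `R`, for the
inverse branches `y ↦ r y` and `y ↦ 1 - q y`. -/
structure IsTailValue (m : ℕ → ℕ) (q r : ℝ) (Z : ℕ → ℝ) : Prop where
  rec_eq : ∀ k, Z k = 1 - q * r ^ m (k + 1) * Z (k + 1)
  nonneg : ∀ k, 0 ≤ Z k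
  le_one : ∀ k, Z k ≤ 1

/-- The value of the tail of the block word of `m` starting at position `n`. -/
noncomputable def posValue (m : ℕ → ℕ) (r : ℝ) (Z : ℕ → ℝ) (n : ℕ) : ℝ :=
  r ^ (rPos m (rCount m n) - n) * Z (rCount m n)

section Values

variable {m : ℕ → ℕ} {q r : ℝ} {Z : ℕ → ℝ}

theorem posValue_rPos (k : ℕ) : posValue m r Z (rPos m k) = Z k := by
  simp [posValue, rCount_rPos]

theorem posValue_zero : posValue m r Z 0 = Z 0 := by
  have := posValue_rPos (m := m) (r := r) (Z := Z) 0
  rwa [rPos_zero] at this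

theorem posValue_R (hZ : IsTailValue m q r Z) {n : ℕ} (h : n = rPos m (rCount m n)) :
    posValue m r Z n = 1 - q * posValue m r Z (n + 1) := by
  have h1 : rCount m (n + 1) = rCount m n + 1 := by rw [rCount, if_pos h]
  have h2 : rPos m (rCount m n + 1) - (n + 1) = m (rCount m n + 1) := by
    rw [rPos_succ, ← h]; omega
  unfold posValue
  rw [h1, h2, ← h, Nat.sub_self, pow_zero, one_mul, hZ.rec_eq]
  ring

theorem posValue_L {n : ℕ} (h : n ≠ rPos m (rCount m n)) :
    posValue m r Z n = r * posValue m r Z (n + 1) := by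
  have h1 : rCount m (n + 1) = rCount m n := by rw [rCount, if_neg h]
  have h3 := le_rPos_rCount m n
  have h2 : rPos m (rCount m n) - n = rPos m (rCount m n) - (n + 1) + 1 := by omega
  unfold posValue
  rw [h1, h2, pow_succ]
  ring

theorem posValue_le (hZ : IsTailValue m q r Z) (hr0 : 0 ≤ r) (hr1 : r ≤ 1) (n : ℕ) :
    posValue m r Z n ≤ Z (rCount m n) :=
  mul_le_of_le_one_left (hZ.nonneg _) (pow_le_one₀ hr0 hr1)

theorem posValue_nonneg (hZ : IsTailValue m q r Z) (hr0 : 0 ≤ r) (n : ℕ) :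
    0 ≤ posValue m r Z n :=
  mul_nonneg (pow_nonneg hr0 _) (hZ.nonneg _)

end Values

/-! ### The tent map in the coordinates `q = (1 - α) / β`, `r = α / β` -/

theorem mem_U_coords {α β : ℝ} (h : (α, β) ∈ U) :
    0 < α ∧ α < 1 ∧ 0 < β ∧ β ≤ 1 ∧ 0 < (1 - α) / β ∧ (1 - α) / β < 1 ∧ 0 < α / β ∧ α / β < 1 ∧
      (1 - α) / β * β = 1 - α ∧ α / β * β = α := by
  obtain ⟨h1, h2, h3, h4⟩ := h
  simp only at h1 h2 h3 h4
  have hβ : 0 < β := by linarith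
  have hα : 0 < α := by linarith
  exact ⟨hα, by linarith, hβ, h2, div_pos (by linarith) hβ, (div_lt_one hβ).2 (by linarith),
    div_pos hα hβ, (div_lt_one hβ).2 h4, div_mul_cancel₀ _ hβ.ne', div_mul_cancel₀ _ hβ.ne'⟩

theorem tent_left {α β x y : ℝ} (hU : (α, β) ∈ U) (hx : x ≤ α) (hxy : x = α / β * y) :
    tent α β x = y := by
  obtain ⟨hα, -, hβ, -⟩ := mem_U_coords hU
  rw [tent, if_pos hx, hxy]
  field_simp

theorem tent_right {α β x y : ℝ} (hU : (α, β) ∈ U) (hx : α < x) (hxy : x = 1 - (1 - α) / β * y) :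
    tent α β x = y := by
  obtain ⟨hα, hα1, hβ, -⟩ := mem_U_coords hU
  have : (1 - α) ≠ 0 := by linarith
  rw [tent, if_neg (not_le.2 hx), hxy]
  field_simp
  ring

theorem eq_of_tent_left {α β x : ℝ} (hU : (α, β) ∈ U) (hx : x ≤ α) :
    x = α / β * tent α β x := by
  obtain ⟨hα, -, hβ, -⟩ := mem_U_coords hU
  rw [tent, if_pos hx]
  field_simp

theorem eq_of_tent_right {α β x : ℝ} (hU : (α, β) ∈ U) (hx : α < x) :
    x = 1 - (1 - α) / β * tent α β x := by
  obtain ⟨hα, hα1, hβ, -⟩ := mem_U_coords hU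
  have : (1 - α) ≠ 0 := by linarith
  rw [tent, if_neg (not_le.2 hx)]
  field_simp
  ring

theorem tent_mem_Icc {α β x : ℝ} (hU : (α, β) ∈ U) (hx : x ∈ Set.Icc (0 : ℝ) 1) :
    tent α β x ∈ Set.Icc (0 : ℝ) 1 := by
  obtain ⟨hα, hα1, hβ, hβ1, -⟩ := mem_U_coords hU
  unfold tent
  split_ifs with h
  · refine ⟨by have := hx.1; positivity, ?_⟩
    rw [div_mul_eq_mul_div, div_le_one hα]
    nlinarith [hx.1]
  · have h1 : 0 < 1 - α := by linarith
    refine ⟨mul_nonneg (by positivity) (by linarith [hx.2]), ?_⟩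
    rw [div_mul_eq_mul_div, div_le_one h1]
    nlinarith [hx.2]

theorem iterate_tent_mem_Icc {α β : ℝ} (hU : (α, β) ∈ U) (n : ℕ) :
    (tent α β)^[n] β ∈ Set.Icc (0 : ℝ) 1 := by
  induction n with
  | zero => exact ⟨(mem_U_coords hU).2.2.1.le, (mem_U_coords hU).2.2.2.1⟩
  | succ n ih => rw [Function.iterate_succ_apply']; exact tent_mem_Icc hU ih

/-! ### Itineraries -/

theorem extItinerary_eq_L_iff {α β x : ℝ} {n : ℕ} :
    extItinerary α β x n = Letter.L ↔ (tent α β)^[n] x < α := by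
  unfold extItinerary
  split_ifs <;> simp_all

theorem extItinerary_eq_R_iff {α β x : ℝ} {n : ℕ} :
    extItinerary α β x n = Letter.R ↔ α < (tent α β)^[n] x := by
  unfold extItinerary
  split_ifs with h1 h2
  · simp [h1.le]
  · simp [h2]
  · simp [lt_of_le_of_ne (not_lt.1 h1) (Ne.symm h2)]

theorem extItinerary_of_itinerary {α β x : ℝ} {n : ℕ} {a : Letter}
    (h : itinerary α β x n = some a) : extItinerary α β x n = a := by
  unfold itinerary at h
  split_ifs at h
  exact Option.some.inj h

theorem blockWord_ne_C (m : ℕ → ℕ) (n : ℕ) : blockWord m n ≠ some Letter.C := by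
  rw [blockWord_eq]
  split_ifs <;> simp

section Kneading

variable {m : ℕ → ℕ} {α β : ℝ} {Z : ℕ → ℝ}

theorem blockWord_R {n : ℕ} (h : n = rPos m (rCount m n)) : blockWord m n = some Letter.R := by
  rw [blockWord_eq, if_pos h]

theorem blockWord_L {n : ℕ} (h : n ≠ rPos m (rCount m n)) : blockWord m n = some Letter.L := by
  rw [blockWord_eq, if_neg h]

/-- A block word has no `C`, so an itinerary that agrees with it so far has not stopped. -/
theorem kneading_eq_some {n : ℕ} (h : ∀ i < n, kneading α β i = blockWord m i) :
    kneading α β n = some (extItinerary α β β n) := by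
  unfold kneading itinerary
  rw [if_neg]
  rintro ⟨k, hk, hC⟩
  have h1 := h k hk
  have h2 : blockWord m k = some (extItinerary α β β k) := by
    rw [blockWord_eq] at h1 ⊢
    split_ifs at h1 ⊢ <;> rw [extItinerary_of_itinerary h1]
  exact blockWord_ne_C m k (by rw [h2, hC])

/-- As long as the kneading sequence follows the block word, the critical orbit consists of the
values of the tails. -/
theorem iterate_tent_eq_posValue (hU : (α, β) ∈ U)
    (hZ : IsTailValue m ((1 - α) / β) (α / β) Z) (h0 : Z 0 = β) {n : ℕ}
    (h : ∀ i < n, kneading α β i = blockWord m i) :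
    (tent α β)^[n] β = posValue m (α / β) Z n := by
  induction n with
  | zero => rw [posValue_zero, h0]; rfl
  | succ n ih =>
    have ih' := ih fun i hi => h i (hi.trans (Nat.lt_succ_self n))
    have hn := h n (Nat.lt_succ_self n)
    rw [Function.iterate_succ_apply', ih']
    by_cases hR : n = rPos m (rCount m n)
    · rw [blockWord_R hR] at hn
      have := extItinerary_eq_R_iff.1 (extItinerary_of_itinerary hn)
      rw [ih'] at this
      exact tent_right hU this (posValue_R hZ hR)
    · rw [blockWord_L hR] at hn
      have := extItinerary_eq_L_iff.1 (extItinerary_of_itinerary hn)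
      rw [ih'] at this
      exact tent_left hU this.le (posValue_L hR)

/-- Both inverse branches send `β` to `α`. A next value below `β` therefore has its `R`-preimage
above `α` and its `L`-preimage below `α`. -/
theorem kneading_eq_blockWord_at (hU : (α, β) ∈ U)
    (hZ : IsTailValue m ((1 - α) / β) (α / β) Z) (h0 : Z 0 = β) {n : ℕ}
    (h : ∀ i < n, kneading α β i = blockWord m i) (hlt : posValue m (α / β) Z (n + 1) < β) :
    kneading α β n = blockWord m n := by
  obtain ⟨hα, hα1, hβ, hβ1, hq0, hq1, hr0, hr1, hq, hr⟩ := mem_U_coords hU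
  have hy := iterate_tent_eq_posValue hU hZ h0 h
  rw [kneading_eq_some h]
  by_cases hR : n = rPos m (rCount m n)
  · rw [blockWord_R hR, extItinerary_eq_R_iff.2]
    rw [hy, posValue_R hZ hR]
    nlinarith
  · rw [blockWord_L hR, extItinerary_eq_L_iff.2]
    rw [hy, posValue_L hR]
    nlinarith

theorem kneading_eq_blockWord (hU : (α, β) ∈ U)
    (hZ : IsTailValue m ((1 - α) / β) (α / β) Z) (h0 : Z 0 = β)
    (hlt : ∀ n, posValue m (α / β) Z (n + 1) < β) : kneading α β = blockWord m := by
  funext n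
  induction n using Nat.strong_induction_on with
  | _ n ih => exact kneading_eq_blockWord_at hU hZ h0 ih (hlt n)

/-- If the values of the tails preceded by an even number of `R`s are smaller than `β`, then the
kneading sequence can only deviate from the block word downwards. -/
theorem prec_blockWord (hU : (α, β) ∈ U)
    (hZ : IsTailValue m ((1 - α) / β) (α / β) Z) (h0 : Z 0 = β)
    (hlt : ∀ n, Even (rCount m (n + 1)) → posValue m (α / β) Z (n + 1) < β)
    (hne : kneading α β ≠ blockWord m) : Word.Prec (kneading α β) (blockWord m) := by
  classical
  obtain ⟨n, hn, hmin⟩ : ∃ n, kneading α β n ≠ blockWord m n ∧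
      ∀ i < n, kneading α β i = blockWord m i := by
    have hex : ∃ n, kneading α β n ≠ blockWord m n := Function.ne_iff.1 hne
    exact ⟨Nat.find hex, Nat.find_spec hex, fun i hi => not_not.1 (Nat.find_min hex hi)⟩
  have hK := kneading_eq_some hmin
  have hodd : ¬ Even (rCount m (n + 1)) := fun he =>
    hn (kneading_eq_blockWord_at hU hZ h0 hmin (hlt n he))
  have hcard : ((Finset.range n).filter fun i => kneading α β i = some Letter.R).card =
      rCount m n := by
    rw [← card_R_blockWord m n]
    congr 1
    exact Finset.filter_congr fun i hi => by rw [hmin i (Finset.mem_range.1 hi)]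
  rw [rCount] at hodd
  -- If `M` has `R` at `n`, the count before `n` is even and the actual letter is smaller. If `M`
  -- has `L`, the count is odd and the actual letter is larger, so the order reverses. Either way `K
  -- ≺ M`.
  by_cases hR : n = rPos m (rCount m n)
  · refine ⟨n, hmin, _, _, hK, blockWord_R hR, Or.inl ⟨?_, ?_⟩⟩
    · rw [if_pos hR, Nat.even_add_one, not_not] at hodd
      rwa [hcard]
    · rw [hK, blockWord_R hR] at hn
      cases h : extItinerary α β β n <;> simp [h, Letter.rank] at hn ⊢
  · refine ⟨n, hmin, _, _, hK, blockWord_L hR, Or.inr ⟨?_, ?_⟩⟩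
    · rw [if_neg hR, Nat.not_even_iff_odd] at hodd
      rwa [hcard]
    · rw [hK, blockWord_L hR] at hn
      cases h : extItinerary α β β n <;> simp [h, Letter.rank] at hn ⊢

/-- On the equi-kneading curve the critical orbit consists of the values of the tails. -/
theorem iterate_tent_eq_posValue_of_kneading_eq (hU : (α, β) ∈ U)
    (hZ : IsTailValue m ((1 - α) / β) (α / β) Z) (hK : kneading α β = blockWord m) (n : ℕ) :
    (tent α β)^[n] β = posValue m (α / β) Z n := by
  obtain ⟨hα, hα1, hβ, hβ1, hq0, hq1, hr0, hr1, hq, hr⟩ := mem_U_coords hU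
  -- Both inverse branches contract by at least `ρ < 1`. Orbit and tail values stay in [0,1] and are
  -- pulled back by the same branches, so they differ by at most `ρ ^ k` for every `k`.
  set ρ := max ((1 - α) / β) (α / β) with hρ
  have hρ0 : 0 ≤ ρ := hq0.le.trans (le_max_left _ _)
  have hρ1 : ρ < 1 := max_lt hq1 hr1
  have hstep : ∀ n, |(tent α β)^[n] β - posValue m (α / β) Z n| ≤
      ρ * |(tent α β)^[n + 1] β - posValue m (α / β) Z (n + 1)| := by
    intro n
    have hn := congrFun hK n
    by_cases hR : n = rPos m (rCount m n)
    · rw [blockWord_R hR] at hn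
      have hx := eq_of_tent_right hU (extItinerary_eq_R_iff.1 (extItinerary_of_itinerary hn))
      rw [← Function.iterate_succ_apply' (tent α β)] at hx
      have : (tent α β)^[n] β - posValue m (α / β) Z n =
          -((1 - α) / β) * ((tent α β)^[n + 1] β - posValue m (α / β) Z (n + 1)) := by
        rw [posValue_R hZ hR]; linear_combination hx
      rw [this, abs_mul, abs_neg, abs_of_pos hq0]
      exact mul_le_mul_of_nonneg_right (le_max_left _ _) (abs_nonneg _)
    · rw [blockWord_L hR] at hn
      have hx := eq_of_tent_left hU (extItinerary_eq_L_iff.1 (extItinerary_of_itinerary hn)).le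
      rw [← Function.iterate_succ_apply' (tent α β)] at hx
      have : (tent α β)^[n] β - posValue m (α / β) Z n =
          α / β * ((tent α β)^[n + 1] β - posValue m (α / β) Z (n + 1)) := by
        rw [posValue_L hR]; linear_combination hx
      rw [this, abs_mul, abs_of_pos hr0]
      exact mul_le_mul_of_nonneg_right (le_max_right _ _) (abs_nonneg _)
  have hbound : ∀ k n, |(tent α β)^[n] β - posValue m (α / β) Z n| ≤ ρ ^ k := by
    intro k
    induction k with
    | zero =>
      intro n
      obtain ⟨h1, h2⟩ := iterate_tent_mem_Icc hU n
      have h3 := posValue_nonneg hZ hr0.le n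
      have h4 := (posValue_le hZ hr0.le hr1.le n).trans (hZ.le_one _)
      rw [pow_zero, abs_le]
      constructor <;> linarith
    | succ k ih =>
      intro n
      rw [pow_succ']
      exact (hstep n).trans (mul_le_mul_of_nonneg_left (ih (n + 1)) hρ0)
  have hlim := ge_of_tendsto' (tendsto_pow_atTop_nhds_zero_of_lt_one hρ0 hρ1)
    fun k => hbound k n
  exact sub_eq_zero.1 (abs_nonpos_iff.1 hlim)

theorem tailValue_zero_of_kneading_eq (hU : (α, β) ∈ U)
    (hZ : IsTailValue m ((1 - α) / β) (α / β) Z) (hK : kneading α β = blockWord m) : Z 0 = β := by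
  have := iterate_tent_eq_posValue_of_kneading_eq hU hZ hK 0
  rw [posValue_zero] at this
  exact this.symm

theorem posValue_lt_of_kneading_eq (hU : (α, β) ∈ U)
    (hZ : IsTailValue m ((1 - α) / β) (α / β) Z) (hK : kneading α β = blockWord m) (n : ℕ) :
    posValue m (α / β) Z (n + 1) < β := by
  obtain ⟨hα, hα1, hβ, hβ1, hq0, hq1, hr0, hr1, hq, hr⟩ := mem_U_coords hU
  have hy := iterate_tent_eq_posValue_of_kneading_eq hU hZ hK n
  have hn := congrFun hK n
  by_contra! hge
  by_cases hR : n = rPos m (rCount m n)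
  · rw [blockWord_R hR] at hn
    have := extItinerary_eq_R_iff.1 (extItinerary_of_itinerary hn)
    rw [hy, posValue_R hZ hR] at this
    nlinarith
  · rw [blockWord_L hR] at hn
    have := extItinerary_eq_L_iff.1 (extItinerary_of_itinerary hn)
    rw [hy, posValue_L hR] at this
    nlinarith

theorem Theta_eq (hU : (α, β) ∈ U) (hZ : IsTailValue m ((1 - α) / β) (α / β) Z) :
    Theta m α β = Z 0 - β := by
  obtain ⟨hα, hα1, hβ, hβ1, hq0, hq1, hr0, hr1, hq, hr⟩ := mem_U_coords hU
  have hsum := (summable_Theta m hU).hasSum.tendsto_sum_nat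
  unfold Theta
  set q := (1 - α) / β
  set r := α / β
  have hpart : ∀ N, ∑ j ∈ Finset.range N,
      (-1 : ℝ) ^ (j + 1) * q ^ (j + 1) * r ^ blockSum m (j + 1) =
        Z 0 - 1 + (-1) ^ N * q ^ N * r ^ blockSum m N * (1 - Z N) := by
    intro N
    induction N with
    | zero => simp [blockSum]
    | succ N ih =>
      rw [Finset.sum_range_succ, ih, hZ.rec_eq N, blockSum_succ]
      ring
  have hlim : Filter.Tendsto
      (fun N => Z 0 - 1 + (-1) ^ N * q ^ N * r ^ blockSum m N * (1 - Z N)) Filter.atTop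
      (nhds (Z 0 - 1 + 0)) := by
    refine Filter.Tendsto.const_add _ (squeeze_zero_norm (a := fun N => q ^ N) (fun N => ?_)
      (tendsto_pow_atTop_nhds_zero_of_lt_one hq0.le hq1))
    have h1 : 0 ≤ 1 - Z N := by linarith [hZ.le_one N]
    rw [norm_mul, norm_mul, norm_mul, norm_pow, norm_neg, norm_one, one_pow, one_mul,
      Real.norm_of_nonneg (pow_nonneg hq0.le _), Real.norm_of_nonneg (pow_nonneg hr0.le _),
      Real.norm_of_nonneg h1, mul_assoc]
    exact mul_le_of_le_one_right (pow_nonneg hq0.le _)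
      (mul_le_one₀ (pow_le_one₀ hr0.le hr1.le) h1 (by linarith [hZ.nonneg N]))
  have := tendsto_nhds_unique hsum (by simpa only [hpart] using hlim)
  rw [this]
  ring

end Kneading

/-! ### The exceptional sequence -/

/-- The block lengths of `R L⁶ (R L⁵ R)²³ R^∞`. -/
def blockLen (k : ℕ) : ℕ := if k = 1 then 6 else if k < 48 ∧ Even k then 5 else 0

/-- The value of `(R L⁵ R)^i R^∞` for the inverse branches `y ↦ r y` and `y ↦ 1 - q y`. -/
noncomputable def oddTail (q r : ℝ) : ℕ → ℝ
  | 0 => 1 / (1 + q)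
  | i + 1 => 1 - q * r ^ 5 * (1 - q * oddTail q r i)

/-- The values of the tails of `R L⁶ (R L⁵ R)²³ R^∞`. -/
noncomputable def tailValue (q r : ℝ) (k : ℕ) : ℝ :=
  if k = 0 then 1 - q * r ^ 6 * oddTail q r 23
  else if Even k then 1 - q * oddTail q r ((46 - k) / 2)
  else oddTail q r ((47 - k) / 2)

section Exceptional

variable {q r : ℝ}

theorem oddTail_mem (hq0 : 0 < q) (hq1 : q < 1) (hr0 : 0 < r) (hr1 : r < 1) (i : ℕ) :
    oddTail q r i ∈ Set.Icc (0 : ℝ) 1 := by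
  induction i with
  | zero =>
    rw [oddTail]
    exact ⟨by positivity, (div_le_one (by linarith)).2 (by linarith)⟩
  | succ i ih =>
    rw [oddTail]
    have h1 : q * r ^ 5 ≤ 1 := mul_le_one₀ hq1.le (by positivity) (pow_le_one₀ hr0.le hr1.le)
    have h2 : 0 ≤ 1 - q * oddTail q r i := by nlinarith [ih.1, ih.2]
    have h3 : 1 - q * oddTail q r i ≤ 1 := by nlinarith [ih.1, ih.2]
    have h4 : 0 ≤ q * r ^ 5 := by positivity
    exact ⟨by nlinarith, by nlinarith⟩

/-- The recursion map `y ↦ 1 - q r⁵ (1 - q y)` is increasing. It raises the starting value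
`1/(1+q)`, the fixed point of `y ↦ 1 - q y`, because `q r⁵ ≤ q`. -/
theorem oddTail_le_succ (hq0 : 0 < q) (hr0 : 0 < r) (hr1 : r < 1) (i : ℕ) :
    oddTail q r i ≤ oddTail q r (i + 1) := by
  induction i with
  | zero =>
    simp only [oddTail]
    have h : q * r ^ 5 ≤ q := mul_le_of_le_one_right hq0.le (pow_le_one₀ hr0.le hr1.le)
    have h1 : 1 - q * (1 / (1 + q)) = 1 / (1 + q) := by field_simp; ring
    rw [h1]
    have h2 : (0 : ℝ) < 1 / (1 + q) := by positivity
    nlinarith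
  | succ i ih =>
    rw [oddTail, oddTail.eq_2 q r (i + 1)]
    have : 0 ≤ q * r ^ 5 * q := by positivity
    nlinarith

theorem oddTail_mono (hq0 : 0 < q) (hr0 : 0 < r) (hr1 : r < 1) : Monotone (oddTail q r) :=
  monotone_nat_of_le_succ (oddTail_le_succ hq0 hr0 hr1)

theorem isTailValue_tailValue (hq0 : 0 < q) (hq1 : q < 1) (hr0 : 0 < r) (hr1 : r < 1) :
    IsTailValue blockLen q r (tailValue q r) := by
  have hmem := oddTail_mem hq0 hq1 hr0 hr1
  have haux : ∀ s, 0 ≤ s → s ≤ 1 → ∀ i, 1 - q * s * oddTail q r i ∈ Set.Icc (0 : ℝ) 1 := by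
    intro s hs0 hs1 i
    have h1 : q * s * oddTail q r i ≤ 1 :=
      mul_le_one₀ (mul_le_one₀ hq1.le hs0 hs1) (hmem i).1 (hmem i).2
    have h2 : 0 ≤ q * s * oddTail q r i := mul_nonneg (mul_nonneg hq0.le hs0) (hmem i).1
    exact ⟨by linarith, by linarith⟩
  have hbd : ∀ k, tailValue q r k ∈ Set.Icc (0 : ℝ) 1 := by
    intro k
    unfold tailValue
    split_ifs
    · exact haux _ (by positivity) (pow_le_one₀ hr0.le hr1.le) _
    · simpa using haux 1 zero_le_one le_rfl ((46 - k) / 2)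
    · exact hmem _
  refine ⟨fun k => ?_, fun k => (hbd k).1, fun k => (hbd k).2⟩
  rcases Nat.eq_zero_or_pos k with rfl | hk
  · simp [tailValue, blockLen]
  rcases Nat.even_or_odd k with he | ho
  · have h1 : ¬ Even (k + 1) := by rw [Nat.even_add_one]; simpa using he
    have h2 : blockLen (k + 1) = 0 := by
      rw [blockLen, if_neg (by omega), if_neg (fun h => h1 h.2)]
    rw [h2, tailValue, if_neg (by omega), if_pos he, tailValue, if_neg (by omega), if_neg h1,
      pow_zero, mul_one, Nat.add_sub_add_right 46 1 k]
  · have h1 : Even (k + 1) := ho.add_one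
    have h3 : ¬ Even k := Nat.not_even_iff_odd.2 ho
    rw [tailValue, if_neg (by omega), if_neg h3, tailValue, if_neg (by omega), if_pos h1]
    by_cases hk' : k + 1 < 48
    · rw [blockLen, if_neg (by omega), if_pos ⟨hk', h1⟩]
      obtain ⟨c, rfl⟩ := ho
      rw [show (47 - (2 * c + 1)) / 2 = (46 - (2 * c + 1 + 1)) / 2 + 1 by omega, oddTail]
    -- Inside `R^∞` the truncated subtractions give index 0, and `1/(1+q)` is fixed by `y ↦ 1 - q
    -- y`.
    · rw [blockLen, if_neg (by omega), if_neg (fun h => hk' h.1)]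
      rw [show (47 - k) / 2 = 0 by omega, show (46 - (k + 1)) / 2 = 0 by omega, oddTail]
      field_simp
      ring

theorem tailValue_one : tailValue q r 1 = oddTail q r 23 := by simp [tailValue]

theorem tailValue_zero : tailValue q r 0 = 1 - q * r ^ 6 * oddTail q r 23 := by simp [tailValue]

/-- On the zero set, the tails starting at an `R` preceded by an even number of `R`s have values
smaller than `β`. -/
theorem tailValue_even_lt {β : ℝ} (hq0 : 0 < q) (hr0 : 0 < r) (hr1 : r < 1)
    (hβ : 1 < β * (1 + q)) {k : ℕ} (hk : 0 < k) (he : Even k) : tailValue q r k < β := by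
  rw [tailValue, if_neg hk.ne', if_pos he]
  have h1 := oddTail_mono hq0 hr0 hr1 (Nat.zero_le ((46 - k) / 2))
  have h2 : oddTail q r 0 < β := by rw [oddTail]; exact (div_lt_iff₀ (by linarith)).2 hβ
  have h3 : 1 - q * oddTail q r 0 = oddTail q r 0 := by rw [oddTail]; field_simp; ring
  nlinarith

theorem tailValue_odd_le (hq0 : 0 < q) (hr0 : 0 < r) (hr1 : r < 1) {k : ℕ} (hk : ¬ Even k) :
    tailValue q r k ≤ oddTail q r 23 := by
  have hk0 : k ≠ 0 := fun h => hk (h ▸ Even.zero)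
  rw [tailValue, if_neg hk0, if_neg hk]
  exact oddTail_mono hq0 hr0 hr1 (by omega)

theorem continuousOn_oddTail {s : Set ℝ} {f g : ℝ → ℝ} (hf : ContinuousOn f s)
    (hg : ContinuousOn g s) (hpos : ∀ t ∈ s, 0 < f t) (i : ℕ) :
    ContinuousOn (fun t => oddTail (f t) (g t) i) s := by
  induction i with
  | zero =>
    simp only [oddTail]
    exact continuousOn_const.div (continuousOn_const.add hf) fun t ht => by
      have := hpos t ht; positivity
  | succ i ih =>
    simp only [oddTail]
    fun_prop

theorem one_lt_mul_of_mem_U {α β : ℝ} (hU : (α, β) ∈ U) : 1 < β * (1 + (1 - α) / β) := by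
  have h : α < β := hU.2.2.2
  have := (mem_U_coords hU).2.2.2.2.2.2.2.2.1
  linarith

theorem isTailValue_of_mem_U {α β : ℝ} (hU : (α, β) ∈ U) :
    IsTailValue blockLen ((1 - α) / β) (α / β) (tailValue ((1 - α) / β) (α / β)) := by
  obtain ⟨-, -, -, -, hq0, hq1, hr0, hr1, -⟩ := mem_U_coords hU
  exact isTailValue_tailValue hq0 hq1 hr0 hr1

theorem prec_of_Theta_eq_zero {α β : ℝ} (hU : (α, β) ∈ U) (h : Theta blockLen α β = 0)
    (hne : kneading α β ≠ blockWord blockLen) :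
    Word.Prec (kneading α β) (blockWord blockLen) := by
  obtain ⟨-, -, -, -, hq0, hq1, hr0, hr1, -⟩ := mem_U_coords hU
  have hZ := isTailValue_of_mem_U hU
  rw [Theta_eq hU hZ, sub_eq_zero] at h
  exact prec_blockWord hU hZ h (fun n he => (posValue_le hZ hr0.le hr1.le _).trans_lt
    (tailValue_even_lt hq0 hr0 hr1 (one_lt_mul_of_mem_U hU)
      (rCount_pos _ n.succ_pos) he)) hne

theorem Theta_eq_zero_of_kneading_eq {α β : ℝ} (hU : (α, β) ∈ U)
    (hK : kneading α β = blockWord blockLen) : Theta blockLen α β = 0 := by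
  have hZ := isTailValue_of_mem_U hU
  rw [Theta_eq hU hZ, tailValue_zero_of_kneading_eq hU hZ hK, sub_self]

theorem oddTail_lt_of_kneading_eq {α β : ℝ} (hU : (α, β) ∈ U)
    (hK : kneading α β = blockWord blockLen) :
    oddTail ((1 - α) / β) (α / β) 23 < β := by
  -- Position 7 carries the second `R`, just after `R L⁶`.
  have h := posValue_lt_of_kneading_eq hU (isTailValue_of_mem_U hU) hK 6
  rwa [show 6 + 1 = rPos blockLen 1 by simp [rPos, blockSum, blockLen], posValue_rPos,
    tailValue_one] at h

theorem kneading_eq_of_oddTail_lt {α β : ℝ} (hU : (α, β) ∈ U)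
    (h0 : tailValue ((1 - α) / β) (α / β) 0 = β)
    (hlt : oddTail ((1 - α) / β) (α / β) 23 < β) : kneading α β = blockWord blockLen := by
  obtain ⟨-, -, -, -, hq0, hq1, hr0, hr1, -⟩ := mem_U_coords hU
  have hZ := isTailValue_of_mem_U hU
  refine kneading_eq_blockWord hU hZ h0 fun n =>
    (posValue_le hZ hr0.le hr1.le _).trans_lt ?_
  by_cases he : Even (rCount blockLen (n + 1))
  · exact tailValue_even_lt hq0 hr0 hr1 (one_lt_mul_of_mem_U hU) (rCount_pos _ n.succ_pos) he
  · exact (tailValue_odd_le hq0 hr0 hr1 he).trans_lt hlt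

/-! ### Realization by a symmetric tent map -/

/-- On the diagonal `β = 1/(2t)`. A value below `β` has successor below `1 - t⁶/2`, and `1 - t⁶/2 ≤
1/(2t)` is the hypothesis `2t ≤ 1 + t⁷`. -/
theorem oddTail_diag_lt {t : ℝ} (ht0 : 0 < t) (ht1 : t < 1) (h : 2 * t ≤ 1 + t ^ 7) (i : ℕ) :
    oddTail t t i < 1 / (2 * t) := by
  induction i with
  | zero =>
    rw [oddTail]
    exact one_div_lt_one_div_of_lt (by linarith) (by linarith)
  | succ i ih =>
    rw [oddTail]
    have h1 : t * oddTail t t i < 1 / 2 := by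
      rw [lt_div_iff₀ (by linarith)] at ih
      linarith
    have h2 : 0 < t * t ^ 5 := by positivity
    have h3 : 1 - t * t ^ 5 * (1 / 2) ≤ 1 / (2 * t) := by
      rw [le_div_iff₀ (by linarith)]
      nlinarith
    nlinarith

theorem exists_diag_zero : ∃ t : ℝ, 1 / 2 ≤ t ∧ t < 1 ∧ 2 * t ≤ 1 + t ^ 7 ∧
    1 - t * t ^ 6 * oddTail t t 23 = 1 / (2 * t) := by
  -- At `t₀` one has `1 - t₀⁷ β = β` for `β = 1/(2t₀)`. Since the odd tail lies below `β` there, `Z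
  -- 0 - β` is nonnegative at `t₀`, while it is nonpositive at `1/2`.
  obtain ⟨t₀, ⟨h1, h2⟩, h3⟩ : ∃ t₀ ∈ Set.Icc (1 / 2 : ℝ) (3 / 5), 1 + t₀ ^ 7 - 2 * t₀ = 0 :=
    intermediate_value_Icc' (f := fun t : ℝ => 1 + t ^ 7 - 2 * t) (by norm_num)
      (by fun_prop) ⟨by norm_num, by norm_num⟩
  have hcont : ContinuousOn
      (fun t : ℝ => 1 - t * t ^ 6 * oddTail t t 23 - 1 / (2 * t)) (Set.Icc (1 / 2) t₀) := by
    have h := continuousOn_oddTail (s := Set.Icc (1 / 2) t₀) (f := fun t => t) (g := fun t => t)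
      continuousOn_id continuousOn_id (fun t ht => by linarith [ht.1]) 23
    refine ContinuousOn.sub (by fun_prop) (continuousOn_const.div (by fun_prop) fun t ht => ?_)
    have := ht.1
    linarith
  have hmem := oddTail_mem (q := 1 / 2) (r := 1 / 2) (by norm_num) (by norm_num) (by norm_num)
    (by norm_num) 23
  have hlt := oddTail_diag_lt (t := t₀) (by linarith) (by linarith) (by linarith) 23
  obtain ⟨t, ⟨ht1, ht2⟩, ht⟩ := intermediate_value_Icc h1 hcont (show (0 : ℝ) ∈ _ from
    ⟨by norm_num; exact hmem.1, by
      have hpos : 0 < t₀ * t₀ ^ 6 := by positivity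
      have : 1 - t₀ * t₀ ^ 6 * (1 / (2 * t₀)) = 1 / (2 * t₀) := by
        field_simp
        linarith
      nlinarith⟩)
  refine ⟨t, ht1, by linarith, ?_, sub_eq_zero.1 ht⟩
  -- To carry `2t ≤ 1 + t⁷` from `t₀` down to `t`: `t₀⁷ - t⁷ ≤ 2 (t₀ - t)`, as the cofactor is at
  -- most `7 (3/5)⁶ ≤ 2`.
  have hpow : ∀ a b : ℕ, t₀ ^ a * t ^ b ≤ (3 / 5) ^ (a + b) := fun a b => by
    rw [pow_add]
    exact mul_le_mul (pow_le_pow_left₀ (by linarith) h2 a)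
      (pow_le_pow_left₀ (by linarith) (ht2.trans h2) b) (by positivity) (by positivity)
  have hfac : t₀ ^ 7 - t ^ 7 = (t₀ - t) * (t₀ ^ 6 * t ^ 0 + t₀ ^ 5 * t ^ 1 + t₀ ^ 4 * t ^ 2 +
      t₀ ^ 3 * t ^ 3 + t₀ ^ 2 * t ^ 4 + t₀ ^ 1 * t ^ 5 + t₀ ^ 0 * t ^ 6) := by ring
  have hle : t₀ ^ 6 * t ^ 0 + t₀ ^ 5 * t ^ 1 + t₀ ^ 4 * t ^ 2 +
      t₀ ^ 3 * t ^ 3 + t₀ ^ 2 * t ^ 4 + t₀ ^ 1 * t ^ 5 + t₀ ^ 0 * t ^ 6 ≤ 2 := by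
    have e : 7 * (3 / 5 : ℝ) ^ 6 ≤ 2 := by norm_num
    linarith [hpow 6 0, hpow 5 1, hpow 4 2, hpow 3 3, hpow 2 4, hpow 1 5, hpow 0 6]
  nlinarith [mul_le_mul_of_nonneg_left hle (sub_nonneg.2 ht2)]

theorem blockWord_mem_kneadingClass : blockWord blockLen ∈ kneadingClass := by
  obtain ⟨t, ht0, ht1, ht, h⟩ := exists_diag_zero
  have hβ : 1 / 2 < 1 / (2 * t) := one_div_lt_one_div_of_lt (by linarith) (by linarith)
  have hβ1 : 1 / (2 * t) ≤ 1 := (div_le_one (by linarith)).2 (by linarith)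
  have hq : (1 - 1 / 2) / (1 / (2 * t)) = t := by field_simp; ring
  have hr : (1 / 2) / (1 / (2 * t)) = t := by field_simp
  refine ⟨1 / (2 * t), hβ, hβ1, ?_⟩
  refine kneading_eq_of_oddTail_lt ⟨hβ, hβ1, ?_, hβ⟩ ?_ ?_
  · show 1 - 1 / (2 * t) < 1 / 2
    linarith
  · rw [hq, hr, tailValue_zero, h]
  · rw [hq, hr]
    exact oddTail_diag_lt (by linarith) ht1 ht 23

/-! ### The exceptional zero -/

/-- The bound on `r` covers `0.4875/β` for all `β ≥ 0.52` (0.9375 at the endpoint), and 0.637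
exceeds the right endpoint 0.56 of the range of `β`. -/
theorem oddTail_one_ge (hq0 : 0 < q) (hq1 : q ≤ 1) (hr0 : 0 < r) (hr : r ≤ 0.9376) :
    0.637 ≤ oddTail q r 1 := by
  simp only [oddTail]
  have h1 : 1 - q * (1 / (1 + q)) = 1 / (1 + q) := by field_simp; ring
  have h2 : q * (1 / (1 + q)) ≤ 1 / 2 := by
    rw [mul_one_div, div_le_iff₀ (by linarith)]
    linarith
  have h3 : r ^ 5 ≤ 0.9376 ^ 5 := pow_le_pow_left₀ hr0.le hr 5
  have h4 : 0 ≤ q * (1 / (1 + q)) := by positivity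
  have h5 : r ^ 5 * (q * (1 / (1 + q))) ≤ 0.9376 ^ 5 * (1 / 2) :=
    mul_le_mul h3 h2 h4 (by norm_num)
  rw [h1]
  norm_num at h5 ⊢
  linarith

theorem exists_exceptional_zero : ∃ β : ℝ, ((0.4875 : ℝ), β) ∈ U ∧ Theta blockLen 0.4875 β = 0 ∧
    kneading 0.4875 β ≠ blockWord blockLen := by
  have hcont : ContinuousOn (fun β : ℝ => 1 - (1 - 0.4875) / β * (0.4875 / β) ^ 6 *
      oddTail ((1 - 0.4875) / β) (0.4875 / β) 23 - β) (Set.Icc 0.52 0.56) := by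
    have hf : ContinuousOn (fun β : ℝ => (1 - 0.4875) / β) (Set.Icc 0.52 0.56) :=
      continuousOn_const.div continuousOn_id fun t ht => by
        have := ht.1; norm_num at this; exact (show (0 : ℝ) < t by linarith).ne'
    have hg : ContinuousOn (fun β : ℝ => 0.4875 / β) (Set.Icc 0.52 0.56) :=
      continuousOn_const.div continuousOn_id fun t ht => by
        have := ht.1; norm_num at this; exact (show (0 : ℝ) < t by linarith).ne'
    have h := continuousOn_oddTail hf hg (fun t ht => by
      have := ht.1
      norm_num at this
      exact div_pos (by norm_num) (by linarith)) 23
    fun_prop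
  -- At 0.52, `q r⁶ ≥ 0.668` and `Z 1 ≥ 0.73` force `Z 0 ≤ 0.52`. At 0.56, `q r⁶ ≤ 0.44` and `Z 1 ≤
  -- 1` force `Z 0 ≥ 0.56`.
  obtain ⟨β, ⟨hβ1, hβ2⟩, hβ⟩ := intermediate_value_Icc (by norm_num) hcont
    (show (0 : ℝ) ∈ _ from by
      constructor
      · set q : ℝ := (1 - 0.4875) / 0.52 with hq
        set r : ℝ := 0.4875 / 0.52 with hr
        have hm := oddTail_mono (q := q) (r := r) (by rw [hq]; norm_num) (by rw [hr]; norm_num)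
          (by rw [hr]; norm_num) (show 2 ≤ 23 by norm_num)
        have h1 := oddTail_one_ge (q := q) (r := r) (by rw [hq]; norm_num)
          (by rw [hq]; norm_num) (by rw [hr]; norm_num) (by rw [hr]; norm_num)
        have h2 : (0.73 : ℝ) ≤ oddTail q r 2 := by
          have hpos : q * r ^ 5 * (1 - q * 0.637) ≤ 0.27 := by rw [hq, hr]; norm_num
          have hqr : 0 ≤ q * r ^ 5 * q := by rw [hq, hr]; norm_num
          rw [oddTail]
          norm_num at hpos h1 ⊢
          nlinarith
        have h3 : (0.668 : ℝ) ≤ q * r ^ 6 := by rw [hq, hr]; norm_num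
        have h4 := mul_le_mul h3 (h2.trans hm) (by norm_num) ((by norm_num : (0 : ℝ) ≤ 0.668).trans h3)
        show 1 - q * r ^ 6 * oddTail q r 23 - 0.52 ≤ 0
        have h5 : (0.48 : ℝ) ≤ 0.668 * 0.73 := by norm_num
        linarith
      · have hmem := oddTail_mem (q := (1 - 0.4875) / 0.56) (r := 0.4875 / 0.56) (by norm_num)
          (by norm_num) (by norm_num) (by norm_num) 23
        have h3 : (1 - 0.4875 : ℝ) / 0.56 * (0.4875 / 0.56) ^ 6 ≤ 0.44 := by norm_num
        have h4 := mul_le_mul h3 hmem.2 hmem.1 (by norm_num)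
        norm_num at h4 ⊢
        linarith)
  norm_num at hβ1 hβ2
  have hU : ((0.4875 : ℝ), β) ∈ U :=
    ⟨by simp only; linarith, by simp only; linarith, by simp only; norm_num; linarith,
      by simp only; norm_num; linarith⟩
  refine ⟨β, hU, ?_, fun hK => ?_⟩
  · rw [Theta_eq hU (isTailValue_of_mem_U hU), tailValue_zero]
    exact hβ
  · obtain ⟨-, -, hβ0, -, hq0, hq1, hr0, hr1, -⟩ := mem_U_coords hU
    have h1 := oddTail_lt_of_kneading_eq hU hK
    have h2 := oddTail_mono hq0 hr0 hr1 (show 1 ≤ 23 by norm_num)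
    have h3 := oddTail_one_ge hq0 hq1.le hr0 (by
      rw [div_le_iff₀ hβ0]
      norm_num
      linarith)
    norm_num at h1 h2 h3
    linarith

end Exceptional

end SkewTent

theorem mainTheorem3 :
    ∃ (M : Word) (m : ℕ → ℕ),
      -- the explicit sequence
      M = blockWord m ∧
      m 1 = 6 ∧
      (∀ k : ℕ, 1 ≤ k → k ≤ 23 → m (2 * k) = 5 ∧ m (2 * k + 1) = 0) ∧
      (∀ k : ℕ, 48 ≤ k → m k = 0) ∧
      M ∈ kneadingClassInf \ {wordRL} ∧
      -- the exceptional zero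
      (∃ α β : ℝ, (α, β) ∈ U ∧ α = 0.4875 ∧ Theta m α β = 0 ∧ kneading α β ≠ M ∧
        Word.Prec (kneading α β) M) ∧
      -- at every exceptional zero the kneading sequence is smaller than `M`
      (∀ α β : ℝ, (α, β) ∈ U → Theta m α β = 0 → kneading α β ≠ M →
        Word.Prec (kneading α β) M) ∧
      -- the equi-kneading curve is a proper subset of the zero set
      {p : ℝ × ℝ | p ∈ U ∧ kneading p.1 p.2 = M} ⊂ {p : ℝ × ℝ | p ∈ U ∧ Theta m p.1 p.2 = 0} := by
  obtain ⟨β, hU, h0, hne⟩ := exists_exceptional_zero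
  refine ⟨blockWord blockLen, blockLen, rfl, rfl, fun k h1 h2 => ⟨?_, ?_⟩, fun k hk => ?_,
    ⟨⟨blockWord_mem_kneadingClass, blockWord_ne_C _⟩, fun h => ?_⟩,
    ⟨0.4875, β, hU, rfl, h0, hne, prec_of_Theta_eq_zero hU h0 hne⟩,
    fun _ _ => prec_of_Theta_eq_zero, fun p hp => ⟨hp.1, Theta_eq_zero_of_kneading_eq hp.1 hp.2⟩,
    fun h => hne (h (show ((0.4875 : ℝ), β) ∈ _ from ⟨hU, h0⟩)).2⟩
  · rw [blockLen, if_neg (by omega), if_pos ⟨by omega, even_two_mul k⟩]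
  · rw [blockLen, if_neg (by omega), if_neg fun h => by have := h.2; grind]
  · rw [blockLen, if_neg (by omega), if_neg (by omega)]
  · have h7 : blockWord blockLen 7 = wordRL 7 := congrFun h 7
    have hR := blockWord_R (m := blockLen) (n := rPos blockLen 1) (by rw [rCount_rPos])
    rw [show rPos blockLen 1 = 7 by simp [rPos, blockSum, blockLen], h7] at hR
    simp [wordRL] at hR
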